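/- Let $a,b,c$ be pairwise relatively prime positive integers, and let $\mathcal T\subset\mathbb R^3$ be the convex hull of $(a,0,0)$, $(0,b,0)$, $(0,0,c)$ and $(0,0,0)$. For positive integers $m,n$ let $$ s(m,n) := \sum_{k=0}^{n-1} \left(\!\left(\frac{km}{n}\right)\!\right)\left(\!\left(\frac{k}{n}\right)\!\right) $$ be the Dedekind sum, where $((x)) := x-\lfloor x\rfloor-\frac12$ if $x\notin\mathbb Z$ and $((x)):=0$ if $x\in\mathbb Z$. Then the Ehrhart polynomial of $\mathcal T$, that is, the polynomial $L_{\mathcal T}$ with $L_{\mathcal T}(t)=\#\left(t\mathcal T\cap\mathbb Z^3\right)$ for every positive integer $t$, is $$ L_{\mathcal T}(t)=\frac{abc}{6}\,t^3+\frac{ab+ac+bc+1}{4}\,t^2+\left(\frac34+\frac{a+b+c}{4}+\frac1{12}\left(\frac{bc}{a}+\frac{ca}{b}+\frac{ab}{c}+\frac1{abc}\right)-s(bc,a)-s(ca,b)-s(ab,c)\right)t+1 . $$ -/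

import Mathlib

open scoped Pointwise

/-- The sawtooth function `((x))`: it is `{x} - 1/2` for `x ∉ ℤ`, and `0` for `x ∈ ℤ`. -/
noncomputable def sawtooth (x : ℝ) : ℝ :=
  open Classical in if x ∈ Set.range ((↑) : ℤ → ℝ) then 0 else Int.fract x - 1 / 2

/-- The Dedekind sum `s(a, b) = ∑_{k = 0}^{b - 1} ((k a / b)) ((k / b))`. -/
noncomputable def dedekindSum (a b : ℕ) : ℝ :=
  ∑ k ∈ Finset.range b, sawtooth ((k : ℝ) * (a : ℝ) / (b : ℝ)) * sawtooth ((k : ℝ) / (b : ℝ))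

/-- The integer points of the dilate `t P` of a subset `P` of `ℝ^d`, i.e. `t P ∩ ℤ^d`. -/
def dilateIntegerPoints {d : ℕ} (P : Set (Fin d → ℝ)) (t : ℕ) : Set (Fin d → ℤ) :=
  {m | (fun i => (m i : ℝ)) ∈ (t : ℝ) • P}

/-- `p` is the Ehrhart polynomial of `P`: for every positive integer `t`, the set `t P ∩ ℤ^d` is
finite and has exactly `p(t)` elements. (A polynomial is determined by its values at the positive
integers, so there is at most one such `p`.) -/
def IsEhrhartPolynomial {d : ℕ} (P : Set (Fin d → ℝ)) (p : Polynomial ℝ) : Prop :=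
  ∀ t : ℕ, 0 < t →
    (dilateIntegerPoints P t).Finite ∧ ((dilateIntegerPoints P t).ncard : ℝ) = p.eval (t : ℝ)

/-- The tetrahedron with vertices `(a,0,0)`, `(0,b,0)`, `(0,0,c)` and `(0,0,0)`. -/
def mordellPommersheimTetrahedron (a b c : ℕ) : Set (Fin 3 → ℝ) :=
  convexHull ℝ {![(a : ℝ), 0, 0], ![0, (b : ℝ), 0], ![0, 0, (c : ℝ)], ![0, 0, 0]}

/-!
The points of `t 𝒯 ∩ ℤ³` are the nonnegative integer solutions of
`b c x + c a y + a b z ≤ a b c t`; they are counted along the planes `b c x + c a y + a b z = n`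
for `0 ≤ n ≤ a b c t`, without generating functions.

As `a`, `b`, `c` are pairwise coprime, every integer `n` is uniquely
`b c x + c a y + a b z + a b c q` with `0 ≤ x < a`, `0 ≤ y < b`, `0 ≤ z < c` and `q` an integer.
The solutions in the plane of index `n` are then `(x + a i, y + b j, z + c k)` with `i + j + k = q`,
so there are `(q + 1) (q + 2) / 2` of them (`ncard_slicePoints`); this also holds for `q = -1, -2`,
the only negative values that occur.

Adding `a b c` to `n` adds `1` to `q`, so summing over `n` requires only the first two moments of
`q` over one period `0 ≤ s < a b c` (`sum_digitQuotient`, `sum_digitQuotient_sq`). Since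
`q = s / (a b c) - x / a - y / b - z / c`, and since `s ↦ (x, y, z)` is a bijection by the Chinese
remainder theorem (`sum_range_digits`), all terms of the expanded square are elementary except the
correlations `∑ s x`, `∑ s y`, `∑ s z`. As `s ≡ b c x` modulo `a`, the first is a Dedekind sum
`s(b c, a)` up to elementary terms, and likewise the other two (`sum_mul_residueDigit`).
-/

open Finset

/-! ### Residue digits -/

/-- The `M`-digit of `s` modulo `a`: the residue `x` with `0 ≤ x < a` and `M * x ≡ s [MOD a]`,
for `M` coprime to `a`. It is `s` times the inverse of `M` in `ZMod a`, reduced modulo `a`. -/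
def residueDigit (M a s : ℕ) : ℕ := s * ((M : ZMod a)⁻¹).val % a

theorem residueDigit_lt {M a : ℕ} (ha : 0 < a) (s : ℕ) : residueDigit M a s < a :=
  Nat.mod_lt _ ha

theorem residueDigit_eq_of_modEq {M a s s' : ℕ} (h : s ≡ s' [MOD a]) :
    residueDigit M a s = residueDigit M a s' :=
  h.mul_right _

theorem mul_residueDigit_modEq {M a : ℕ} (ha : 0 < a) (h : Nat.Coprime M a) (s : ℕ) :
    M * residueDigit M a s ≡ s [MOD a] := by
  have : NeZero a := ⟨ha.ne'⟩
  rw [← ZMod.natCast_eq_natCast_iff]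
  have h1 := ZMod.coe_mul_inv_eq_one M h
  simp only [residueDigit, Nat.cast_mul, ZMod.natCast_mod, ZMod.natCast_val, ZMod.cast_id', id]
  calc (M : ZMod a) * (s * (M : ZMod a)⁻¹) = s * (M * (M : ZMod a)⁻¹) := by ring
    _ = s := by rw [h1, mul_one]

theorem residueDigit_mul_mod {M a : ℕ} (h : Nat.Coprime M a) {k : ℕ} (hk : k < a) :
    residueDigit M a (k * M % a) = k := by
  have ha : 0 < a := by omega
  have h1 : M * residueDigit M a (k * M % a) ≡ M * k [MOD a] := by
    refine (mul_residueDigit_modEq ha h _).trans ?_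
    rw [mul_comm M k]
    exact Nat.mod_modEq _ _
  have h2 := Nat.ModEq.cancel_left_of_coprime (Nat.coprime_comm.mp h) h1
  exact Nat.ModEq.eq_of_lt_of_lt h2 (residueDigit_lt ha _) hk

/-- Multiplication by `M` permutes the residues modulo `a`, with the digit as inverse. -/
theorem sum_range_residueDigit {M a : ℕ} (ha : 0 < a) (h : Nat.Coprime M a) (F : ℕ → ℕ → ℝ) :
    ∑ r ∈ range a, F r (residueDigit M a r) = ∑ k ∈ range a, F (k * M % a) k := by
  refine Finset.sum_bij' (fun r _ => residueDigit M a r) (fun k _ => k * M % a) ?_ ?_ ?_ ?_ ?_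
  · exact fun r _ => mem_range.2 (residueDigit_lt ha r)
  · exact fun k _ => mem_range.2 (Nat.mod_lt _ ha)
  · intro r hr
    rw [mul_comm]
    exact Nat.ModEq.eq_of_lt_of_lt ((Nat.mod_modEq _ _).trans (mul_residueDigit_modEq ha h r))
      (Nat.mod_lt _ ha) (mem_range.1 hr)
  · exact fun k hk => residueDigit_mul_mod h (mem_range.1 hk)
  · intro r hr
    congr 1
    rw [mul_comm]
    exact (Nat.ModEq.eq_of_lt_of_lt ((Nat.mod_modEq _ _).trans (mul_residueDigit_modEq ha h r))
      (Nat.mod_lt _ ha) (mem_range.1 hr)).symm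

/-! ### Elementary sums -/

theorem sum_range_natCast (n : ℕ) : ∑ k ∈ range n, (k : ℝ) = n * (n - 1) / 2 := by
  induction n with
  | zero => simp
  | succ n ih => rw [sum_range_succ, ih]; push_cast; ring

theorem sum_range_natCast_sq (n : ℕ) :
    ∑ k ∈ range n, (k : ℝ) ^ 2 = n * (n - 1) * (2 * n - 1) / 6 := by
  induction n with
  | zero => simp
  | succ n ih => rw [sum_range_succ, ih]; push_cast; ring

theorem sum_range_mul (f : ℕ → ℝ) (a m : ℕ) :
    ∑ s ∈ range (a * m), f s = ∑ k ∈ range m, ∑ r ∈ range a, f (a * k + r) := by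
  induction m with
  | zero => simp
  | succ m ih => rw [sum_range_succ, ← ih, Nat.mul_succ, sum_range_add]

/-! ### Dedekind sums -/

theorem sawtooth_natCast_div {a k : ℕ} (ha : 0 < a) (hk : k % a ≠ 0) :
    sawtooth ((k : ℝ) / a) = ((k % a : ℕ) : ℝ) / a - 1 / 2 := by
  have hfr : Int.fract ((k : ℝ) / a) = ((k % a : ℕ) : ℝ) / a := by
    have := Int.fract_div_natCast_eq_div_natCast_mod (k := ℝ) (m := k) (n := a)
    simpa using this
  rw [sawtooth, if_neg, hfr]
  rintro ⟨z, hz⟩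
  rw [← hz, Int.fract_intCast] at hfr
  have ha' : (a : ℝ) ≠ 0 := by positivity
  have : ((k % a : ℕ) : ℝ) = 0 := by
    rcases div_eq_zero_iff.1 hfr.symm with h | h
    · exact h
    · exact absurd h ha'
  exact hk (by exact_mod_cast this)

theorem sawtooth_zero : sawtooth 0 = 0 := by
  rw [sawtooth, if_pos ⟨0, by simp⟩]

theorem dedekindSum_eq_sum_residues {M a : ℕ} (ha : 0 < a) (h : Nat.Coprime M a) :
    dedekindSum M a
      = (∑ k ∈ range a, (k : ℝ) * ((k * M % a : ℕ) : ℝ)) / a ^ 2 - ((a : ℝ) - 1) / 4 := by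
  have ha' : (a : ℝ) ≠ 0 := by positivity
  -- The summand at `k = 0` vanishes on the left, while the product formula gives `1 / 4` there.
  have key : ∀ k ∈ range a, sawtooth ((k : ℝ) * M / a) * sawtooth ((k : ℝ) / a)
      = (((k * M % a : ℕ) : ℝ) / a - 1 / 2) * ((k : ℝ) / a - 1 / 2)
        - if k = 0 then 1 / 4 else 0 := by
    intro k hk
    rcases Nat.eq_zero_or_pos k with rfl | hk0
    · simp [sawtooth_zero]; norm_num
    · have hka := mem_range.1 hk
      have h1 : k % a = k := Nat.mod_eq_of_lt hka
      have h2 : k * M % a ≠ 0 := fun h0 =>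
        absurd (Nat.le_of_dvd hk0
          ((Nat.coprime_comm.mp h).dvd_of_dvd_mul_right (Nat.dvd_of_mod_eq_zero h0))) (by omega)
      have e1 := sawtooth_natCast_div ha h2
      have e2 := sawtooth_natCast_div (k := k) ha (by omega)
      rw [h1] at e2
      push_cast at e1
      rw [e1, e2, if_neg (by omega)]
      ring
  have hs : ∑ k ∈ range a, ((k * M % a : ℕ) : ℝ) = a * (a - 1) / 2 := by
    rw [← sum_range_residueDigit ha h (fun r _ => (r : ℝ)), sum_range_natCast]
  rw [dedekindSum, sum_congr rfl key, sum_sub_distrib, sum_ite_eq',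
    if_pos (mem_range.2 ha)]
  have e : ∀ k ∈ range a, (((k * M % a : ℕ) : ℝ) / a - 1 / 2) * ((k : ℝ) / a - 1 / 2)
      = (k : ℝ) * ((k * M % a : ℕ) : ℝ) * (1 / a ^ 2) - ((k * M % a : ℕ) : ℝ) * (1 / (2 * a))
        - (k : ℝ) * (1 / (2 * a)) + 1 / 4 := by
    intro k _
    field_simp
    ring
  rw [sum_congr rfl e, sum_add_distrib, sum_sub_distrib, sum_sub_distrib, ← sum_mul, ← sum_mul,
    ← sum_mul, hs, sum_range_natCast, sum_const, card_range, nsmul_eq_mul]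
  field_simp
  ring

/-- The correlation of `s` with its digit over a full period `a * M` is a Dedekind sum, up to
elementary terms: on each block `s = a * k + r` the digit depends on `r` only. -/
theorem sum_mul_residueDigit {M a : ℕ} (ha : 0 < a) (h : Nat.Coprime M a) :
    ∑ s ∈ range (a * M), (s : ℝ) * (residueDigit M a s : ℝ)
      = M * a ^ 2 * (dedekindSum M a + (a - 1) / 4 + (M - 1) * (a - 1) / 4) := by
  have ha' : (a : ℝ) ≠ 0 := by positivity
  have hper : ∀ k r, residueDigit M a (a * k + r) = residueDigit M a r := fun k r =>
    residueDigit_eq_of_modEq (by simp [Nat.ModEq])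
  have hd : ∑ r ∈ range a, (residueDigit M a r : ℝ) = a * (a - 1) / 2 := by
    rw [sum_range_residueDigit ha h (fun _ k => (k : ℝ)), sum_range_natCast]
  have hrd : ∑ r ∈ range a, (r : ℝ) * (residueDigit M a r : ℝ)
      = a ^ 2 * (dedekindSum M a + (a - 1) / 4) := by
    rw [sum_range_residueDigit ha h (fun r k => (r : ℝ) * (k : ℝ)),
      dedekindSum_eq_sum_residues ha h]
    simp only [mul_comm]
    field_simp
    ring
  rw [sum_range_mul]
  have e : ∀ k ∈ range M, ∑ r ∈ range a,
      (((a * k + r : ℕ) : ℝ)) * (residueDigit M a (a * k + r) : ℝ)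
      = (k : ℝ) * (a * (a * (a - 1) / 2)) + a ^ 2 * (dedekindSum M a + (a - 1) / 4) := by
    intro k _
    rw [← hrd, ← hd]
    simp only [hper, Nat.cast_add, Nat.cast_mul, add_mul, sum_add_distrib, mul_sum]
    congr 1
    exact sum_congr rfl fun r _ => by ring
  rw [sum_congr rfl e, sum_add_distrib, ← sum_mul, sum_range_natCast, sum_const, card_range,
    nsmul_eq_mul]
  ring

/-! ### Digit expansions modulo `a * b * c` -/

/-- The integer `q` with `s = b c x + c a y + a b z + a b c q`, where `x`, `y`, `z` are the digits
of `s` modulo `a`, `b`, `c`. The division is exact for pairwise coprime `a`, `b`, `c`. -/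
def digitQuotient (a b c s : ℕ) : ℤ :=
  ((s : ℤ) - b * c * residueDigit (b * c) a s - c * a * residueDigit (c * a) b s
    - a * b * residueDigit (a * b) c s) / (a * b * c)

section Digits

variable {a b c : ℕ}

theorem digitQuotient_spec (ha : 0 < a) (hb : 0 < b) (hc : 0 < c)
    (hab : Nat.Coprime a b) (hbc : Nat.Coprime b c) (hca : Nat.Coprime c a) (s : ℕ) :
    (b * c * residueDigit (b * c) a s + c * a * residueDigit (c * a) b s
      + a * b * residueDigit (a * b) c s + a * b * c * digitQuotient a b c s : ℤ) = s := by
  have h1 := (Nat.modEq_iff_dvd.1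
    (mul_residueDigit_modEq ha (Nat.Coprime.mul_left hab.symm hca) s))
  have h2 := (Nat.modEq_iff_dvd.1
    (mul_residueDigit_modEq hb (Nat.Coprime.mul_left hbc.symm hab) s))
  have h3 := (Nat.modEq_iff_dvd.1
    (mul_residueDigit_modEq hc (Nat.Coprime.mul_left hca.symm hbc) s))
  push_cast at h1 h2 h3
  rw [digitQuotient]
  set x : ℤ := (residueDigit (b * c) a s : ℤ)
  set y : ℤ := (residueDigit (c * a) b s : ℤ)
  set z : ℤ := (residueDigit (a * b) c s : ℤ)
  set D : ℤ := (s : ℤ) - b * c * x - c * a * y - a * b * z with hD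
  have da : (a : ℤ) ∣ D := by
    have : D = (s - b * c * x) - a * (c * y + b * z) := by rw [hD]; ring
    rw [this]
    exact dvd_sub h1 (dvd_mul_right _ _)
  have db : (b : ℤ) ∣ D := by
    have : D = (s - c * a * y) - b * (c * x + a * z) := by rw [hD]; ring
    rw [this]
    exact dvd_sub h2 (dvd_mul_right _ _)
  have dc : (c : ℤ) ∣ D := by
    have : D = (s - a * b * z) - c * (b * x + a * y) := by rw [hD]; ring
    rw [this]
    exact dvd_sub h3 (dvd_mul_right _ _)
  have cab : IsCoprime (a : ℤ) (b : ℤ) := Nat.isCoprime_iff_coprime.2 hab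
  have cbc : IsCoprime (b : ℤ) (c : ℤ) := Nat.isCoprime_iff_coprime.2 hbc
  have cac : IsCoprime (a : ℤ) (c : ℤ) := Nat.isCoprime_iff_coprime.2 hca.symm
  have hdiv : ((a : ℤ) * b * c) ∣ D :=
    IsCoprime.mul_dvd (IsCoprime.mul_left cac cbc) (cab.mul_dvd da db) dc
  rw [Int.mul_ediv_cancel' hdiv, hD]
  ring

theorem digitQuotient_add_mul (ha : 0 < a) (hb : 0 < b) (hc : 0 < c) (m s : ℕ) :
    digitQuotient a b c (a * b * c * m + s) = digitQuotient a b c s + m := by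
  have e1 : residueDigit (b * c) a (a * b * c * m + s) = residueDigit (b * c) a s :=
    residueDigit_eq_of_modEq (by simp [Nat.ModEq, mul_assoc])
  have e2 : residueDigit (c * a) b (a * b * c * m + s) = residueDigit (c * a) b s :=
    residueDigit_eq_of_modEq (by
      rw [show a * b * c * m + s = b * (a * c * m) + s by ring]; simp [Nat.ModEq])
  have e3 : residueDigit (a * b) c (a * b * c * m + s) = residueDigit (a * b) c s :=
    residueDigit_eq_of_modEq (by
      rw [show a * b * c * m + s = c * (a * b * m) + s by ring]; simp [Nat.ModEq])
  have hN : ((a : ℤ) * b * c) ≠ 0 := by positivity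
  rw [digitQuotient, digitQuotient, e1, e2, e3, ← Int.add_mul_ediv_left _ _ hN]
  congr 1
  push_cast
  ring

theorem digitQuotient_zero : digitQuotient a b c 0 = 0 := by
  simp [digitQuotient, residueDigit]

/-- The Chinese remainder theorem: the digits give a bijection between the residues modulo
`a * b * c` and the triples of residues modulo `a`, `b`, `c`. -/
theorem sum_range_digits (ha : 0 < a) (hb : 0 < b) (hc : 0 < c)
    (hab : Nat.Coprime a b) (hbc : Nat.Coprime b c) (hca : Nat.Coprime c a)
    (F : ℕ → ℕ → ℕ → ℝ) :
    ∑ s ∈ range (a * b * c),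
        F (residueDigit (b * c) a s) (residueDigit (c * a) b s) (residueDigit (a * b) c s)
      = ∑ x ∈ range a, ∑ y ∈ range b, ∑ z ∈ range c, F x y z := by
  let φ : ℕ → ℕ × ℕ × ℕ := fun s =>
    (residueDigit (b * c) a s, residueDigit (c * a) b s, residueDigit (a * b) c s)
  have hinj : Set.InjOn φ (range (a * b * c) : Finset ℕ) := by
    intro s hs s' hs' h
    simp only [coe_range, Set.mem_Iio] at hs hs'
    simp only [φ, Prod.mk.injEq] at h
    obtain ⟨h1, h2, h3⟩ := h
    have m1 : s ≡ s' [MOD a] := by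
      have u := mul_residueDigit_modEq ha (Nat.Coprime.mul_left hab.symm hca) s
      rw [h1] at u
      exact u.symm.trans (mul_residueDigit_modEq ha (Nat.Coprime.mul_left hab.symm hca) s')
    have m2 : s ≡ s' [MOD b] := by
      have u := mul_residueDigit_modEq hb (Nat.Coprime.mul_left hbc.symm hab) s
      rw [h2] at u
      exact u.symm.trans (mul_residueDigit_modEq hb (Nat.Coprime.mul_left hbc.symm hab) s')
    have m3 : s ≡ s' [MOD c] := by
      have u := mul_residueDigit_modEq hc (Nat.Coprime.mul_left hca.symm hbc) s
      rw [h3] at u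
      exact u.symm.trans (mul_residueDigit_modEq hc (Nat.Coprime.mul_left hca.symm hbc) s')
    have m12 := (Nat.modEq_and_modEq_iff_modEq_mul hab).1 ⟨m1, m2⟩
    have m123 := (Nat.modEq_and_modEq_iff_modEq_mul
      (Nat.Coprime.mul_left hca.symm hbc)).1 ⟨m12, m3⟩
    exact Nat.ModEq.eq_of_lt_of_lt m123 hs hs'
  have himg : (range (a * b * c)).image φ = range a ×ˢ range b ×ˢ range c := by
    refine Finset.eq_of_subset_of_card_le ?_ ?_
    · intro p hp
      obtain ⟨s, _, rfl⟩ := mem_image.1 hp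
      simp [φ, residueDigit_lt ha, residueDigit_lt hb, residueDigit_lt hc]
    · rw [card_image_of_injOn hinj]
      simp [mul_assoc]
  calc _ = ∑ s ∈ range (a * b * c), (fun p : ℕ × ℕ × ℕ => F p.1 p.2.1 p.2.2) (φ s) := rfl
    _ = ∑ p ∈ (range (a * b * c)).image φ, F p.1 p.2.1 p.2.2 := 
        (sum_image (f := fun p : ℕ × ℕ × ℕ => F p.1 p.2.1 p.2.2) hinj).symm
    _ = _ := by rw [himg, sum_product]; simp only [sum_product]

theorem digitQuotient_cast (ha : 0 < a) (hb : 0 < b) (hc : 0 < c)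
    (hab : Nat.Coprime a b) (hbc : Nat.Coprime b c) (hca : Nat.Coprime c a) (s : ℕ) :
    (digitQuotient a b c s : ℝ) = s / (a * b * c) - (residueDigit (b * c) a s / a
      + residueDigit (c * a) b s / b + residueDigit (a * b) c s / c) := by
  have h : (b * c * residueDigit (b * c) a s + c * a * residueDigit (c * a) b s
      + a * b * residueDigit (a * b) c s + a * b * c * digitQuotient a b c s : ℝ) = s := by
    exact_mod_cast digitQuotient_spec ha hb hc hab hbc hca s
  rw [← h]
  field_simp
  ring

theorem neg_three_lt_digitQuotient (ha : 0 < a) (hb : 0 < b) (hc : 0 < c)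
    (hab : Nat.Coprime a b) (hbc : Nat.Coprime b c) (hca : Nat.Coprime c a) (s : ℕ) :
    -3 < digitQuotient a b c s := by
  have h := digitQuotient_cast ha hb hc hab hbc hca s
  have h0 : (0 : ℝ) ≤ s / (a * b * c) := by positivity
  have h1 : (residueDigit (b * c) a s : ℝ) / a < 1 := by
    rw [div_lt_one (by positivity)]; exact_mod_cast residueDigit_lt ha s
  have h2 : (residueDigit (c * a) b s : ℝ) / b < 1 := by
    rw [div_lt_one (by positivity)]; exact_mod_cast residueDigit_lt hb s
  have h3 : (residueDigit (a * b) c s : ℝ) / c < 1 := by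
    rw [div_lt_one (by positivity)]; exact_mod_cast residueDigit_lt hc s
  have : (-3 : ℝ) < digitQuotient a b c s := by linarith
  exact_mod_cast this

/-! ### Moments of the quotient over a period -/

theorem sum_digitQuotient (ha : 0 < a) (hb : 0 < b) (hc : 0 < c)
    (hab : Nat.Coprime a b) (hbc : Nat.Coprime b c) (hca : Nat.Coprime c a) :
    ∑ s ∈ range (a * b * c), (digitQuotient a b c s : ℝ)
      = -(a * b * c) - 1 / 2 + (a * b + b * c + c * a) / 2 := by
  have hF := sum_range_digits ha hb hc hab hbc hca
    (fun x y z => (x : ℝ) / a + (y : ℝ) / b + (z : ℝ) / c)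
  rw [sum_congr rfl fun s _ => digitQuotient_cast ha hb hc hab hbc hca s, sum_sub_distrib, hF,
    ← sum_div, sum_range_natCast]
  simp only [sum_add_distrib, ← sum_div, sum_const, card_range, nsmul_eq_mul, sum_range_natCast,
    ← mul_sum]
  push_cast
  field_simp
  ring

theorem sum_digitQuotient_sq (ha : 0 < a) (hb : 0 < b) (hc : 0 < c)
    (hab : Nat.Coprime a b) (hbc : Nat.Coprime b c) (hca : Nat.Coprime c a) :
    ∑ s ∈ range (a * b * c), (digitQuotient a b c s : ℝ) ^ 2
      = -(1 / 2) + 4 / 3 * (a * b * c) - (a * b + b * c + c * a) + (a + b + c) / 2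
        + 1 / 6 * (b * c / a + c * a / b + a * b / c + 1 / (a * b * c))
        - 2 * (dedekindSum (b * c) a + dedekindSum (c * a) b + dedekindSum (a * b) c) := by
  have hF := sum_range_digits ha hb hc hab hbc hca
    (fun x y z => ((x : ℝ) / a + (y : ℝ) / b + (z : ℝ) / c) ^ 2)
  have hX := sum_mul_residueDigit ha (Nat.Coprime.mul_left hab.symm hca)
  have hY := sum_mul_residueDigit hb (Nat.Coprime.mul_left hbc.symm hab)
  have hZ := sum_mul_residueDigit hc (Nat.Coprime.mul_left hca.symm hbc)
  rw [show a * (b * c) = a * b * c by ring] at hX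
  rw [show b * (c * a) = a * b * c by ring] at hY
  rw [show c * (a * b) = a * b * c by ring] at hZ
  have e : ∀ s ∈ range (a * b * c), (digitQuotient a b c s : ℝ) ^ 2
      = (s : ℝ) ^ 2 * (1 / (a * b * c) ^ 2)
        - (s : ℝ) * residueDigit (b * c) a s * (2 / (a * b * c * a))
        - (s : ℝ) * residueDigit (c * a) b s * (2 / (a * b * c * b))
        - (s : ℝ) * residueDigit (a * b) c s * (2 / (a * b * c * c))
        + (residueDigit (b * c) a s / a + residueDigit (c * a) b s / b
            + residueDigit (a * b) c s / c : ℝ) ^ 2 := by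
    intro s _
    rw [digitQuotient_cast ha hb hc hab hbc hca]
    field_simp
    ring
  have hq : ∑ x ∈ range a, ∑ y ∈ range b, ∑ z ∈ range c,
      ((x : ℝ) / a + (y : ℝ) / b + (z : ℝ) / c) ^ 2
      = b * c * ((a - 1) * (2 * a - 1) / (6 * a)) + c * a * ((b - 1) * (2 * b - 1) / (6 * b))
        + a * b * ((c - 1) * (2 * c - 1) / (6 * c))
        + c * ((a - 1) * (b - 1) / 2) + a * ((b - 1) * (c - 1) / 2)
        + b * ((c - 1) * (a - 1) / 2) := by
    have e2 : ∀ x y z : ℕ, ((x : ℝ) / a + (y : ℝ) / b + (z : ℝ) / c) ^ 2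
        = (x : ℝ) ^ 2 / a ^ 2 + (y : ℝ) ^ 2 / b ^ 2 + (z : ℝ) ^ 2 / c ^ 2
          + 2 / (a * b) * (x * y) + 2 / (b * c) * (y * z) + 2 / (c * a) * (x * z) := by
      intro x y z
      field_simp
      ring
    simp only [e2, sum_add_distrib, ← sum_div, sum_const, card_range, nsmul_eq_mul,
      ← mul_sum, ← sum_mul, sum_range_natCast, sum_range_natCast_sq]
    field_simp
  rw [sum_congr rfl e, sum_add_distrib, sum_sub_distrib, sum_sub_distrib, sum_sub_distrib,
    ← sum_mul, ← sum_mul, ← sum_mul, ← sum_mul, hX, hY, hZ, hF, hq, sum_range_natCast_sq]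
  push_cast
  field_simp
  ring

/-! ### Counting the lattice points of a slice -/

/-- The lattice points with nonnegative coordinates on the plane `b c x + c a y + a b z = n`. -/
def slicePoints (a b c : ℕ) (n : ℤ) : Set (Fin 3 → ℤ) :=
  {m | (∀ i, 0 ≤ m i) ∧ (b * c * m 0 + c * a * m 1 + a * b * m 2 : ℤ) = n}

/-- A nonnegative integer congruent modulo `a` to a digit `x < a` is `x + a * i` with `i ≥ 0`. -/
theorem exists_eq_add_mul_of_dvd_sub {a x : ℕ} (hx : x < a) {u : ℤ} (hu : 0 ≤ u)
    (h : (a : ℤ) ∣ u - x) : ∃ i : ℕ, u = x + a * i := by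
  obtain ⟨i, hi⟩ := h
  have hi0 : 0 ≤ i := by
    by_contra hneg
    have h1 : i ≤ -1 := by omega
    have h2 : (a : ℤ) * i ≤ a * (-1) := mul_le_mul_of_nonneg_left h1 (by positivity)
    have h3 : (x : ℤ) < a := by exact_mod_cast hx
    linarith
  lift i to ℕ using hi0
  exact ⟨i, by linarith⟩

theorem slicePoints_decomposition (ha : 0 < a) (hb : 0 < b) (hc : 0 < c)
    (hab : Nat.Coprime a b) (hbc : Nat.Coprime b c) (hca : Nat.Coprime c a) {n : ℤ} {q : ℤ}
    {x y z : ℕ} (hx : x < a) (hy : y < b) (hz : z < c)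
    (h : (b * c * x + c * a * y + a * b * z + a * b * c * q : ℤ) = n) {m : Fin 3 → ℤ}
    (hm : m ∈ slicePoints a b c n) :
    ∃ i j k : ℕ, m 0 = x + a * i ∧ m 1 = y + b * j ∧ m 2 = z + c * k ∧ (i + j + k : ℤ) = q := by
  obtain ⟨hm0, hm⟩ := hm
  have cab : IsCoprime (a : ℤ) (b : ℤ) := Nat.isCoprime_iff_coprime.2 hab
  have cbc : IsCoprime (b : ℤ) (c : ℤ) := Nat.isCoprime_iff_coprime.2 hbc
  have cca : IsCoprime (c : ℤ) (a : ℤ) := Nat.isCoprime_iff_coprime.2 hca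
  have d1 : (a : ℤ) ∣ m 0 - x := by
    refine (cab.mul_right cca.symm).dvd_of_dvd_mul_left
      ⟨c * y + b * z + b * c * q - c * m 1 - b * m 2, ?_⟩
    linear_combination hm - h
  have d2 : (b : ℤ) ∣ m 1 - y := by
    refine (cbc.mul_right cab.symm).dvd_of_dvd_mul_left
      ⟨c * x + a * z + a * c * q - c * m 0 - a * m 2, ?_⟩
    linear_combination hm - h
  have d3 : (c : ℤ) ∣ m 2 - z := by
    refine (cca.mul_right cbc.symm).dvd_of_dvd_mul_left
      ⟨b * x + a * y + a * b * q - b * m 0 - a * m 1, ?_⟩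
    linear_combination hm - h
  obtain ⟨i, hi⟩ := exists_eq_add_mul_of_dvd_sub hx (hm0 0) d1
  obtain ⟨j, hj⟩ := exists_eq_add_mul_of_dvd_sub hy (hm0 1) d2
  obtain ⟨k, hk⟩ := exists_eq_add_mul_of_dvd_sub hz (hm0 2) d3
  refine ⟨i, j, k, hi, hj, hk, ?_⟩
  have hN : ((a : ℤ) * b * c) ≠ 0 := by positivity
  apply mul_left_cancel₀ hN
  rw [hi, hj, hk] at hm
  linear_combination hm - h

/-- The slice consists of the points `(x + a i, y + b j, z + c k)` with `i + j + k = q`, of which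
there are `(q + 1) (q + 2) / 2`. The formula also covers `q = -1` and `q = -2`, where there is no
such point. -/
theorem ncard_slicePoints (ha : 0 < a) (hb : 0 < b) (hc : 0 < c)
    (hab : Nat.Coprime a b) (hbc : Nat.Coprime b c) (hca : Nat.Coprime c a) {n : ℤ} {q : ℤ}
    (hq : -3 < q) {x y z : ℕ} (hx : x < a) (hy : y < b) (hz : z < c)
    (h : (b * c * x + c * a * y + a * b * z + a * b * c * q : ℤ) = n) :
    (slicePoints a b c n).Finite ∧
      ((slicePoints a b c n).ncard : ℝ) = ((q : ℝ) + 1) * (q + 2) / 2 := by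
  rcases lt_or_ge q 0 with hneg | hnn
  · have hem : slicePoints a b c n = ∅ := by
      rw [Set.eq_empty_iff_forall_notMem]
      intro m hm
      obtain ⟨i, j, k, -, -, -, hs⟩ :=
        slicePoints_decomposition ha hb hc hab hbc hca hx hy hz h hm
      omega
    rw [hem]
    refine ⟨Set.finite_empty, ?_⟩
    rcases (show q = -1 ∨ q = -2 by omega) with rfl | rfl <;> simp
  · lift q to ℕ using hnn
    -- A pair `i ≤ p ≤ q` encodes the triple `(i, p - i, q - p)` with sum `q`.
    let S : Finset (Σ _ : ℕ, ℕ) := (range (q + 1)).sigma fun p => range (p + 1)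
    let g : (Σ _ : ℕ, ℕ) → Fin 3 → ℤ := fun u =>
      ![x + a * (u.2 : ℤ), y + b * ((u.1 : ℤ) - u.2), z + c * ((q : ℤ) - u.1)]
    have ha' : (a : ℤ) ≠ 0 := by positivity
    have hc' : (c : ℤ) ≠ 0 := by positivity
    have hg : Function.Injective g := by
      rintro ⟨p, i⟩ ⟨p', i'⟩ he
      have h0 := congrFun he 0
      have h2 := congrFun he 2
      simp only [g, Matrix.cons_val_zero, Matrix.cons_val, add_right_inj] at h0 h2
      have h0' := mul_left_cancel₀ ha' h0
      have h2' := mul_left_cancel₀ hc' h2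
      obtain rfl : i = i' := by omega
      obtain rfl : p = p' := by omega
      rfl
    have hS : slicePoints a b c n = g '' S := by
      ext m
      constructor
      · intro hm
        obtain ⟨i, j, k, h0, h1, h2, hs⟩ :=
          slicePoints_decomposition ha hb hc hab hbc hca hx hy hz h hm
        refine ⟨⟨i + j, i⟩, ?_, ?_⟩
        · simp only [S, coe_sigma, Set.mem_sigma_iff, coe_range, Set.mem_Iio]
          omega
        · ext l
          fin_cases l
          · simp [g, h0]
          · simp [g, h1]
          · simp [g, h2, ← hs]
      · rintro ⟨⟨p, i⟩, hu, rfl⟩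
        simp only [S, coe_sigma, Set.mem_sigma_iff, coe_range, Set.mem_Iio] at hu
        have h1 : (0 : ℤ) ≤ (p : ℤ) - i := by omega
        have h2 : (0 : ℤ) ≤ (q : ℤ) - p := by omega
        refine ⟨fun l => ?_, ?_⟩
        · fin_cases l
          · change (0 : ℤ) ≤ x + a * (i : ℤ)
            positivity
          · change (0 : ℤ) ≤ y + b * ((p : ℤ) - i)
            positivity
          · change (0 : ℤ) ≤ z + c * ((q : ℤ) - p)
            positivity
        · change (b * c * (x + a * (i : ℤ)) + c * a * (y + b * ((p : ℤ) - i))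
            + a * b * (z + c * ((q : ℤ) - p)) : ℤ) = n
          linear_combination h
    rw [hS]
    refine ⟨S.finite_toSet.image g, ?_⟩
    rw [Set.ncard_image_of_injective _ hg, Set.ncard_coe_finset, card_sigma]
    simp only [card_range]
    push_cast
    rw [sum_add_distrib, sum_range_natCast, sum_const, card_range, nsmul_eq_mul]
    push_cast
    ring

end Digits

/-! ### The tetrahedron -/

theorem mem_mordellPommersheimTetrahedron_iff {a b c : ℕ} (ha : 0 < a) (hb : 0 < b) (hc : 0 < c)
    (p : Fin 3 → ℝ) :
    p ∈ mordellPommersheimTetrahedron a b c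
      ↔ (∀ i, 0 ≤ p i) ∧ p 0 / a + p 1 / b + p 2 / c ≤ 1 := by
  constructor
  · intro hp
    have hconv : Convex ℝ {p : Fin 3 → ℝ | (∀ i, 0 ≤ p i) ∧ p 0 / a + p 1 / b + p 2 / c ≤ 1} := by
      rintro u ⟨hu, hu1⟩ v ⟨hv, hv1⟩ s t hs ht hst
      refine ⟨fun i => ?_, ?_⟩
      · have := hu i
        have := hv i
        simp only [Pi.add_apply, Pi.smul_apply, smul_eq_mul]
        positivity
      · simp only [Pi.add_apply, Pi.smul_apply, smul_eq_mul]
        calc _ = s * (u 0 / a + u 1 / b + u 2 / c) + t * (v 0 / a + v 1 / b + v 2 / c) := by ring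
          _ ≤ s * 1 + t * 1 := by gcongr
          _ = 1 := by linarith
    refine convexHull_min ?_ hconv hp
    have ha' : (a : ℝ) ≠ 0 := by positivity
    have hb' : (b : ℝ) ≠ 0 := by positivity
    have hc' : (c : ℝ) ≠ 0 := by positivity
    rintro u (rfl | rfl | rfl | rfl) <;>
      refine ⟨fun i => by fin_cases i <;> simp, by simp [ha', hb', hc']⟩
  · rintro ⟨h0, h1⟩
    have hT := convex_convexHull ℝ
      ({![(a : ℝ), 0, 0], ![0, (b : ℝ), 0], ![0, 0, (c : ℝ)], ![0, 0, 0]} : Set (Fin 3 → ℝ))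
    have hp := hT.sum_mem (t := (Finset.univ : Finset (Fin 4)))
      (w := ![p 0 / a, p 1 / b, p 2 / c, 1 - (p 0 / a + p 1 / b + p 2 / c)])
      (z := ![![(a : ℝ), 0, 0], ![0, (b : ℝ), 0], ![0, 0, (c : ℝ)], ![0, 0, 0]])
      (by
        intro i _
        have := h0 0
        have := h0 1
        have := h0 2
        fin_cases i
        · change 0 ≤ p 0 / a; positivity
        · change 0 ≤ p 1 / b; positivity
        · change 0 ≤ p 2 / c; positivity
        · change 0 ≤ 1 - (p 0 / a + p 1 / b + p 2 / c); linarith)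
      (by simp [Fin.sum_univ_four])
      (by
        intro i _
        apply subset_convexHull
        fin_cases i <;> simp)
    rw [mordellPommersheimTetrahedron]
    convert hp using 1
    ext i
    fin_cases i <;> simp [Fin.sum_univ_four] <;> field_simp

theorem dilateIntegerPoints_tetrahedron {a b c : ℕ} (ha : 0 < a) (hb : 0 < b) (hc : 0 < c)
    {t : ℕ} (ht : 0 < t) :
    dilateIntegerPoints (mordellPommersheimTetrahedron a b c) t
      = ⋃ n ∈ range (a * b * c * t + 1), slicePoints a b c n := by
  have ht' : (t : ℝ) ≠ 0 := by positivity
  ext m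
  simp only [dilateIntegerPoints, Set.mem_ofPred_eq, Set.mem_iUnion, exists_prop, mem_range]
  rw [Set.mem_smul_set_iff_inv_smul_mem₀ ht', mem_mordellPommersheimTetrahedron_iff ha hb hc]
  simp only [Pi.smul_apply, smul_eq_mul]
  have hpos : (∀ i, 0 ≤ (t : ℝ)⁻¹ * (m i : ℝ)) ↔ ∀ i, 0 ≤ m i := by
    refine forall_congr' fun i => ?_
    rw [mul_nonneg_iff_of_pos_left (by positivity)]
    exact_mod_cast Iff.rfl
  have hle : (t : ℝ)⁻¹ * (m 0 : ℝ) / a + (t : ℝ)⁻¹ * (m 1 : ℝ) / b + (t : ℝ)⁻¹ * (m 2 : ℝ) / c ≤ 1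
      ↔ (b * c * m 0 + c * a * m 1 + a * b * m 2 : ℤ) ≤ a * b * c * t := by
    have e : (t : ℝ)⁻¹ * (m 0 : ℝ) / a + (t : ℝ)⁻¹ * (m 1 : ℝ) / b + (t : ℝ)⁻¹ * (m 2 : ℝ) / c
        = (b * c * m 0 + c * a * m 1 + a * b * m 2) / (a * b * c * t) := by
      field_simp
    rw [e, div_le_one (by positivity)]
    exact_mod_cast Iff.rfl
  rw [hpos, hle]
  constructor
  · rintro ⟨h0, h1⟩
    have hn : (0 : ℤ) ≤ b * c * m 0 + c * a * m 1 + a * b * m 2 := by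
      have := h0 0
      have := h0 1
      have := h0 2
      positivity
    obtain ⟨n, hn⟩ := Int.eq_ofNat_of_zero_le hn
    refine ⟨n, ?_, h0, hn⟩
    rw [hn] at h1
    exact Nat.lt_succ_of_le (by exact_mod_cast h1)
  · rintro ⟨n, hn, h0, h1⟩
    refine ⟨h0, ?_⟩
    rw [h1]
    exact_mod_cast Nat.le_of_lt_succ hn

/-- The lattice points are counted slice by slice, along the planes `b c x + c a y + a b z = n`. -/
theorem ncard_dilateIntegerPoints_tetrahedron {a b c : ℕ} (ha : 0 < a) (hb : 0 < b) (hc : 0 < c)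
    (hab : Nat.Coprime a b) (hbc : Nat.Coprime b c) (hca : Nat.Coprime c a)
    {t : ℕ} (ht : 0 < t) :
    (dilateIntegerPoints (mordellPommersheimTetrahedron a b c) t).Finite ∧
      ((dilateIntegerPoints (mordellPommersheimTetrahedron a b c) t).ncard : ℝ)
        = ∑ n ∈ range (a * b * c * t + 1),
            ((digitQuotient a b c n : ℝ) + 1) * (digitQuotient a b c n + 2) / 2 := by
  have hs : ∀ n : ℕ, (slicePoints a b c n).Finite ∧ ((slicePoints a b c n).ncard : ℝ)
      = ((digitQuotient a b c n : ℝ) + 1) * (digitQuotient a b c n + 2) / 2 := fun n =>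
    ncard_slicePoints ha hb hc hab hbc hca (neg_three_lt_digitQuotient ha hb hc hab hbc hca n)
      (residueDigit_lt ha n) (residueDigit_lt hb n) (residueDigit_lt hc n)
      (digitQuotient_spec ha hb hc hab hbc hca n)
  rw [dilateIntegerPoints_tetrahedron ha hb hc ht]
  refine ⟨(range (a * b * c * t + 1)).finite_toSet.biUnion fun n _ => (hs n).1, ?_⟩
  have hdisj : (↑(range (a * b * c * t + 1)) : Set ℕ).PairwiseDisjoint
      fun n : ℕ => slicePoints a b c n := by
    intro n _ n' _ hne
    refine Set.disjoint_left.2 fun m hm hm' => hne ?_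
    exact_mod_cast hm.2.symm.trans hm'.2
  have hcard : (⋃ n ∈ range (a * b * c * t + 1), slicePoints a b c (n : ℤ)).ncard
      = ∑ n ∈ range (a * b * c * t + 1), (slicePoints a b c (n : ℤ)).ncard := by
    have hU := (range (a * b * c * t + 1)).finite_toSet.ncard_biUnion
      (fun n _ => (hs n).1) hdisj
    rw [finsum_mem_coe_finset] at hU
    simpa only [mem_coe] using hU
  rw [hcard]
  push_cast
  exact sum_congr rfl fun n _ => (hs n).2

theorem mainTheorem3 (a b c : ℕ) (ha : 0 < a) (hb : 0 < b) (hc : 0 < c)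
    (hab : Nat.Coprime a b) (hbc : Nat.Coprime b c) (hca : Nat.Coprime c a) :
    IsEhrhartPolynomial (mordellPommersheimTetrahedron a b c)
      (Polynomial.C ((a : ℝ) * b * c / 6) * Polynomial.X ^ 3
        + Polynomial.C (((a : ℝ) * b + a * c + b * c + 1) / 4) * Polynomial.X ^ 2
        + Polynomial.C (3 / 4 + ((a : ℝ) + b + c) / 4
            + 1 / 12 * ((b : ℝ) * c / a + (c : ℝ) * a / b + (a : ℝ) * b / c
                + 1 / ((a : ℝ) * b * c))
            - dedekindSum (b * c) a - dedekindSum (c * a) b - dedekindSum (a * b) c)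
          * Polynomial.X
        + 1) := by
  intro t ht
  obtain ⟨hfin, hcard⟩ := ncard_dilateIntegerPoints_tetrahedron ha hb hc hab hbc hca ht
  refine ⟨hfin, ?_⟩
  have hlast : digitQuotient a b c (a * b * c * t) = t := by
    simpa [digitQuotient_zero] using digitQuotient_add_mul ha hb hc t 0
  -- On the `m`-th period the quotient is that of the first period, shifted by `m`.
  have hblock : ∀ m ∈ range t, ∑ s ∈ range (a * b * c),
      ((digitQuotient a b c (a * b * c * m + s) : ℝ) + 1)
        * (digitQuotient a b c (a * b * c * m + s) + 2) / 2
      = (a * b * c / 2) * (m : ℝ) ^ 2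
        + (3 * (a * b * c) / 2 + ∑ s ∈ range (a * b * c), (digitQuotient a b c s : ℝ)) * m
        + (a * b * c + 3 / 2 * ∑ s ∈ range (a * b * c), (digitQuotient a b c s : ℝ)
          + 1 / 2 * ∑ s ∈ range (a * b * c), (digitQuotient a b c s : ℝ) ^ 2) := by
    intro m _
    have e : ∀ s ∈ range (a * b * c), ((digitQuotient a b c (a * b * c * m + s) : ℝ) + 1)
        * (digitQuotient a b c (a * b * c * m + s) + 2) / 2
        = (digitQuotient a b c s : ℝ) ^ 2 * (1 / 2)
          + (digitQuotient a b c s : ℝ) * ((m : ℝ) + 3 / 2)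
          + ((m : ℝ) + 1) * (m + 2) / 2 := by
      intro s _
      rw [digitQuotient_add_mul ha hb hc]
      push_cast
      ring
    rw [sum_congr rfl e, sum_add_distrib, sum_add_distrib, ← sum_mul, ← sum_mul, sum_const,
      card_range, nsmul_eq_mul]
    push_cast
    ring
  rw [hcard, sum_range_succ, hlast, sum_range_mul, sum_congr rfl hblock, sum_add_distrib,
    sum_add_distrib, ← mul_sum, ← mul_sum, sum_range_natCast, sum_range_natCast_sq, sum_const,
    card_range, nsmul_eq_mul, sum_digitQuotient ha hb hc hab hbc hca,
    sum_digitQuotient_sq ha hb hc hab hbc hca]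
  simp only [Polynomial.eval_add, Polynomial.eval_mul, Polynomial.eval_C, Polynomial.eval_pow,
    Polynomial.eval_X, Polynomial.eval_one]
  push_cast
  ring
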